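/- Let $N\ge 2$. For $0<s<1$ and $1\le p<\infty$ with $sp<N$, put $q=\frac{Np}{N-sp}$, $\Delta_hf(x)=f(x+h)-f(x)$, and for measurable $f:\mathbb R^N\to\mathbb R$ and $\xi\in\mathbb R^N$ let $$A_\xi(f)=\int_0^\infty t^{-sp-1}\|\Delta_{t\xi}f\|_{L^p}^p\,dt,\qquad |f|_{W^{s,p}}=\Big(\int_{\mathbb R^N}\frac{\|\Delta_hf\|_{L^p}^p}{|h|^{sp+N}}\,dh\Big)^{1/p},$$ $$\mathscr E_{s,p}(f)=\sigma_N^{\frac{N+sp}{Np}}\Big(\int_{\mathbb S^{N-1}}A_\xi(f)^{-\frac{N}{sp}}\,d\mathscr H^{N-1}(\xi)\Big)^{-\frac sN},\qquad \sigma_N=\mathscr H^{N-1}(\mathbb S^{N-1}).$$ Let $\dot W^{s,p}=\{f\in L^1_{loc}:\ |f|_{W^{s,p}}<\infty\}$ and $\mathring W^{s,p}=\{f\in L^q:\ |f|_{W^{s,p}}<\infty\}$. Let $\widetilde C_{s,p,N}$ be the best constant in $\|f\|_{L^q}\le C|f|_{W^{s,p}}$, $f\in\mathring W^{s,p}$,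 and let $C_{s,p,N}$ be the best (Haddad–Ludwig) constant in the affine inequality $\|f\|_{L^q}\le C\,\mathscr E_{s,p}(f)$, $f\in\mathring W^{s,p}$. Let $K^1=K^1_{s,p,N}$ and $K^2=K^2_{s,p,N}$ be the largest, respectively smallest, constants such that $$K^1\sum_{i=1}^NA_{u_i}(f)^{1/p}\le|f|_{W^{s,p}}\le K^2\sum_{i=1}^NA_{u_i}(f)^{1/p}$$ for all $f\in\dot W^{s,p}$ and all orthonormal bases $(u_1,\dots,u_N)$ of $\mathbb R^N$, and set $$C^1_{s,p,N}=\sup\Big\{\frac{K^1-K^2\lambda^{-s/(N-1)}}{(K^2)^2(\lambda^s-\lambda^{-s/(N-1)})}:\ \lambda>\Big(\frac{K^2}{K^1}\Big)^{(N-1)/s}\Big\},\qquad K_{s,p,N}=\frac{\widetilde C_{s,p,N}\,\sigma_N^{-1/p}}{C^1_{s,p,N}}.$$ **Theorem.** For every $N\ge2$ there is a constant $C_N<\infty$, depending only on $N$, such that for all $0<s<1$ and $1\le p<\infty$ with $sp<N$: (i) if $f\in\dot W^{s,p}$ satisfies $|f|_{W^{s,p}}=\min\{|f\circ T|_{W^{s,p}}:\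 T\in \mathrm{SL}_N\}$, then $C^1_{s,p,N}|f|_{W^{s,p}}\le A_\xi(f)^{1/p}$ for all $\xi\in\mathbb S^{N-1}$ (that is, $C^1_{s,p,N}$ is an admissible constant in the estimate on which $K_{s,p,N}$ is based); (ii) $K_{s,p,N}\le C_N\,\widetilde C_{s,p,N}$ and $K_{s,p,N}\le C_N\,C_{s,p,N}$. -/

import Mathlib

open MeasureTheory Set
open scoped ENNReal NNReal

noncomputable section

namespace AffineSobolev

/-- Euclidean space of dimension `N`. -/
abbrev E (N : ℕ) : Type := EuclideanSpace ℝ (Fin N)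

/-- The first order difference `Δ_h f (x) = f (x + h) - f x`. -/
def diff {N : ℕ} (h : E N) (f : E N → ℝ) : E N → ℝ := fun x => f (x + h) - f x

/-- The surface measure of the unit sphere. -/
abbrev surf (N : ℕ) : Measure (Metric.sphere (0 : E N) 1) :=
  (volume : Measure (E N)).toSphere

/-- `σ_N`, the surface area of the unit sphere of `ℝ^N`. -/
def sigma (N : ℕ) : ℝ≥0∞ := surf N univ

/-- The directional quantity `∫_0^∞ t^(-sp-1) ‖Δ_{tξ} f‖_{L^p}^p dt` (for `0 < s < 1`). -/
def dirEnergy {N : ℕ} (s p : ℝ) (f : E N → ℝ) (ξ : E N) : ℝ≥0∞ :=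
  ∫⁻ t in Ioi (0 : ℝ), ENNReal.ofReal (t ^ (-(s * p) - 1)) *
    eLpNorm (diff (t • ξ) f) (ENNReal.ofReal p) volume ^ p

/-- The fractional (Gagliardo) semi-norm
`|f|_{W^{s,p}} = (∫ ‖Δ_h f‖_{L^p}^p / |h|^(sp+N) dh)^(1/p)` (for `0 < s < 1`). -/
def seminorm {N : ℕ} (s p : ℝ) (f : E N → ℝ) : ℝ≥0∞ :=
  (∫⁻ h : E N, eLpNorm (diff h f) (ENNReal.ofReal p) volume ^ p /
    ENNReal.ofReal (‖h‖ ^ (s * p + N))) ^ (1 / p)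

/-- The homogeneous space of all `f ∈ L^1_loc` with `|f|_{W^{s,p}} < ∞`. -/
def MemDotW {N : ℕ} (s p : ℝ) (f : E N → ℝ) : Prop :=
  LocallyIntegrable f volume ∧ seminorm s p f < ∞

/-- The critical exponent `q = Np / (N - sp)`. -/
def critExp (N : ℕ) (s p : ℝ) : ℝ := N * p / (N - s * p)

/-- The space of all `f ∈ L^q`, `q = Np / (N - sp)`, with `|f|_{W^{s,p}} < ∞`. -/
def MemRingW {N : ℕ} (s p : ℝ) (f : E N → ℝ) : Prop :=
  MemLp f (ENNReal.ofReal (critExp N s p)) volume ∧ seminorm s p f < ∞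

/-- The affine energy
`σ_N^((N+sp)/(Np)) (∫_{S^{N-1}} (∫_0^∞ t^(-sp-1) ‖Δ_{tξ} f‖_{L^p}^p dt)^(-N/(sp)) dξ)^(-s/N)`,
with the conventions `0^(-a) = ∞` and `∞^(-a) = 0` for `a > 0`. -/
def affineEnergy {N : ℕ} (s p : ℝ) (f : E N → ℝ) : ℝ≥0∞ :=
  sigma N ^ ((N + s * p) / (N * p)) *
    (∫⁻ ξ : Metric.sphere (0 : E N) 1, dirEnergy s p f (ξ : E N) ^ (-(N / (s * p)))
      ∂(surf N)) ^ (-(s / N))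

/-- The best constant in the Sobolev inequality `‖f‖_{L^q} ≤ C |f|_{W^{s,p}}`. -/
def sobolevConst (N : ℕ) (s p : ℝ) : ℝ≥0∞ :=
  sInf {C : ℝ≥0∞ | ∀ f : E N → ℝ, MemRingW s p f →
    eLpNorm f (ENNReal.ofReal (critExp N s p)) volume ≤ C * seminorm s p f}

/-- The best (Haddad-Ludwig) constant in the affine Sobolev inequality
`‖f‖_{L^q} ≤ C ℰ_{s,p}(f)`. -/
def affineSobolevConst (N : ℕ) (s p : ℝ) : ℝ≥0∞ :=
  sInf {C : ℝ≥0∞ | ∀ f : E N → ℝ, MemRingW s p f →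
    eLpNorm f (ENNReal.ofReal (critExp N s p)) volume ≤ C * affineEnergy s p f}

/-- The sum `∑ i, (∫_0^∞ t^(-sp-1) ‖Δ_{t u_i} f‖_{L^p}^p dt)^(1/p)` over an orthonormal basis. -/
def sliceSum {N : ℕ} (s p : ℝ) (f : E N → ℝ) (u : OrthonormalBasis (Fin N) ℝ (E N)) : ℝ≥0∞ :=
  ∑ i, dirEnergy s p f (u i) ^ (1 / p)

/-- The best (largest) constant `K¹` in the slicing inequality
`K¹ ∑ i, (∫_0^∞ t^(-sp-1) ‖Δ_{t u_i} f‖_{L^p}^p dt)^(1/p) ≤ |f|_{W^{s,p}}`. -/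
def sliceLower (N : ℕ) (s p : ℝ) : ℝ≥0∞ :=
  sSup {K : ℝ≥0∞ | ∀ f : E N → ℝ, MemDotW s p f →
    ∀ u : OrthonormalBasis (Fin N) ℝ (E N), K * sliceSum s p f u ≤ seminorm s p f}

/-- The best (smallest) constant `K²` in the slicing inequality
`|f|_{W^{s,p}} ≤ K² ∑ i, (∫_0^∞ t^(-sp-1) ‖Δ_{t u_i} f‖_{L^p}^p dt)^(1/p)`. -/
def sliceUpper (N : ℕ) (s p : ℝ) : ℝ≥0∞ :=
  sInf {K : ℝ≥0∞ | ∀ f : E N → ℝ, MemDotW s p f →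
    ∀ u : OrthonormalBasis (Fin N) ℝ (E N), seminorm s p f ≤ K * sliceSum s p f u}

/-- The constant
`C¹ = sup { (K¹ - K² λ^(-s/(N-1))) / ((K²)² (λ^s - λ^(-s/(N-1)))) ; λ > (K²/K¹)^((N-1)/s) }`.
For `0 < K¹ ≤ K² < ∞` the condition on `λ` forces `λ > 1` and `K¹ > K² λ^(-s/(N-1))`, so that the
subtractions in `ℝ≥0∞` are genuine ones (no truncation occurs). -/
def minConst (N : ℕ) (s p : ℝ) : ℝ≥0∞ :=
  ⨆ (l : ℝ≥0) (_ : (sliceUpper N s p / sliceLower N s p) ^ (((N : ℝ) - 1) / s) < (l : ℝ≥0∞)),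
    (sliceLower N s p - sliceUpper N s p * (l : ℝ≥0∞) ^ (-(s / ((N : ℝ) - 1)))) /
      (sliceUpper N s p ^ 2 * ((l : ℝ≥0∞) ^ s - (l : ℝ≥0∞) ^ (-(s / ((N : ℝ) - 1)))))

/-- `f` minimizes `|f ∘ T|_{W^{s,p}}` among all linear maps `T` of determinant one. -/
def IsUnimodularMin {N : ℕ} (s p : ℝ) (f : E N → ℝ) : Prop :=
  ∀ T : E N →ₗ[ℝ] E N, LinearMap.det T = 1 → seminorm s p f ≤ seminorm s p (f ∘ T)

/-- The (non-sharp) constant `K_{s,p,N} = C̃_{s,p,N} σ_N^(-1/p) / C¹_{s,p,N}` which the method of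
optimal unimodular transformations gives in the affine Sobolev inequality. -/
def methodConst (N : ℕ) (s p : ℝ) : ℝ≥0∞ :=
  sobolevConst N s p * sigma N ^ (-(1 / p)) / minConst N s p

end AffineSobolev

end

noncomputable section

namespace AffineSobolev

variable {N : ℕ} {s p : ℝ} {f g : E N → ℝ}

/-! Write `A ξ` for the directional energy. As a function of the vector `ξ`, `A ξ ^ (1 / p)` is
even, subadditive and positively homogeneous of degree `s`, and integrating `A` over the sphere
gives the `p`-th power of the seminorm. These facts alone compare the seminorm with slice sums, with
constants depending only on `N` (`sliceSum_le_seminorm`, `seminorm_le_sliceSum`): both sides carry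
the same `s`-dependence, and the `p`-th roots of dimensional constants are bounded uniformly for `1
≤ p`.

For (i), a minimizer is compared with its composition with the determinant-one map that stretches
`ξ` by `λ` and contracts the orthogonal directions; the slicing inequalities then bound `A ξ` from
below (`minConst_mul_seminorm_le`).

For (ii), `λ = (2 K² / K¹) ^ ((N - 1) / s)` makes both powers of `λ` in the formula for `C¹`
independent of `s` once the ratio `K² / K¹` is given, so `C¹` has a dimensional lower bound
(`minConstBound_le`). The affine version follows because Hölder bounds the affine energy by the
seminorm (`affineEnergy_le_seminorm`). -/

/-! ### Finite differences in `L^p`. -/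

theorem diff_congr_ae (hfg : f =ᵐ[volume] g) (h : E N) : diff h f =ᵐ[volume] diff h g := by
  have h1 := (measurePreserving_add_right (volume : Measure (E N)) h).quasiMeasurePreserving.ae_eq_comp
    hfg
  filter_upwards [hfg, h1] with x hx hx1
  simp only [Function.comp_apply] at hx1
  simp [diff, hx, hx1]

theorem aestronglyMeasurable_diff (hf : AEStronglyMeasurable f volume) (h : E N) :
    AEStronglyMeasurable (diff h f) volume :=
  (hf.comp_measurePreserving (measurePreserving_add_right volume h)).sub hf

theorem eLpNorm_diff_comp_add (hf : AEStronglyMeasurable f volume) (q : ℝ≥0∞) (h k : E N) :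
    eLpNorm (fun x => diff h f (x + k)) q volume = eLpNorm (diff h f) q volume := by
  have hk := measurePreserving_add_right (volume : Measure (E N)) k
  exact eLpNorm_comp_measurePreserving (g := diff h f) (p := q) (aestronglyMeasurable_diff hf h) hk

/-- Cocycle identity `Δ_{h+k} f = (Δ_h f)(· + k) + Δ_k f`, translation invariance and Minkowski. -/
theorem eLpNorm_diff_add_le (hf : AEStronglyMeasurable f volume) {q : ℝ≥0∞} (hq : 1 ≤ q)
    (h k : E N) :
    eLpNorm (diff (h + k) f) q volume ≤ eLpNorm (diff h f) q volume + eLpNorm (diff k f) q volume := by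
  have e : diff (h + k) f = (fun x => diff h f (x + k)) + diff k f := by
    ext x
    simp only [diff, Pi.add_apply]
    rw [add_comm h k, ← add_assoc]
    ring
  rw [e, ← eLpNorm_diff_comp_add hf q h k]
  exact eLpNorm_add_le ((aestronglyMeasurable_diff hf h).comp_measurePreserving
    (measurePreserving_add_right volume k)) (aestronglyMeasurable_diff hf k) hq

theorem eLpNorm_diff_neg (hf : AEStronglyMeasurable f volume) (q : ℝ≥0∞) (h : E N) :
    eLpNorm (diff (-h) f) q volume = eLpNorm (diff h f) q volume := by
  rw [← eLpNorm_diff_comp_add hf q (-h) h, ← eLpNorm_neg]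
  congr 1
  ext x
  simp [diff]

theorem measurable_eLpNorm_diff (hp : 1 ≤ p) (hf : AEStronglyMeasurable f volume) :
    Measurable fun h : E N => eLpNorm (diff h f) (ENNReal.ofReal p) volume := by
  have hp0 : 0 < p := by linarith
  -- A measurable representative makes the integrand jointly measurable in `(h, x)`.
  obtain ⟨g, hg, hfg⟩ := hf
  have hg' := hg.measurable
  have e : ∀ h : E N, eLpNorm (diff h f) (ENNReal.ofReal p) volume =
      (∫⁻ x, ‖g (x + h) - g x‖ₑ ^ p) ^ (1 / p) := fun h => by
    rw [eLpNorm_congr_ae (diff_congr_ae hfg h), eLpNorm_eq_lintegral_rpow_enorm_toReal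
      (by simpa using hp0) ENNReal.ofReal_ne_top, ENNReal.toReal_ofReal hp0.le]
    rfl
  simp only [e]
  refine Measurable.pow_const ?_ _
  exact Measurable.lintegral_prod_right' (f := fun z : E N × E N => ‖g (z.2 + z.1) - g z.2‖ₑ ^ p)
    (by fun_prop)

/-! ### The directional energy as a function of the direction. -/

theorem measurable_dirEnergy (hp : 1 ≤ p) (hf : AEStronglyMeasurable f volume) :
    Measurable fun ξ : E N => dirEnergy s p f ξ := by
  have := measurable_eLpNorm_diff hp hf
  refine Measurable.lintegral_prod_right' (ν := volume.restrict (Ioi (0 : ℝ)))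
    (f := fun z : E N × ℝ => ENNReal.ofReal (z.2 ^ (-(s * p) - 1)) *
    eLpNorm (diff (z.2 • z.1) f) (ENNReal.ofReal p) volume ^ p) ?_
  refine Measurable.mul (by fun_prop) (Measurable.pow_const ?_ _)
  exact this.comp (by fun_prop)

theorem dirEnergy_neg (hf : AEStronglyMeasurable f volume) (ξ : E N) :
    dirEnergy s p f (-ξ) = dirEnergy s p f ξ := by
  simp only [dirEnergy, smul_neg, eLpNorm_diff_neg hf]

theorem dirEnergy_zero (hp : 1 ≤ p) : dirEnergy s p f 0 = 0 := by
  have : diff (0 : E N) f = 0 := by ext; simp [diff]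
  simp [dirEnergy, this, show 0 < p by linarith]

theorem dirEnergy_smul {c : ℝ} (hc : 0 < c) (ξ : E N) :
    dirEnergy s p f (c • ξ) = ENNReal.ofReal (c ^ (s * p)) * dirEnergy s p f ξ := by
  have himg : (fun t : ℝ => c * t) '' Ioi 0 = Ioi 0 := by simp [image_mul_left_Ioi hc]
  have hsub := lintegral_image_eq_lintegral_abs_deriv_mul (s := Ioi (0 : ℝ)) measurableSet_Ioi
    (f := fun t => c * t) (f' := fun _ => c)
    (fun t _ => by simpa using ((hasDerivAt_id t).const_mul c).hasDerivWithinAt)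
    (fun a _ b _ hab => mul_left_cancel₀ hc.ne' hab)
    (fun t => ENNReal.ofReal (t ^ (-(s * p) - 1)) *
    eLpNorm (diff (t • ξ) f) (ENNReal.ofReal p) volume ^ p)
  rw [himg] at hsub
  unfold dirEnergy
  rw [hsub, ← lintegral_const_mul' _ _ ENNReal.ofReal_ne_top]
  refine setLIntegral_congr_fun measurableSet_Ioi fun t (ht : 0 < t) => ?_
  rw [← mul_assoc, ← mul_assoc, ← ENNReal.ofReal_mul (by positivity),
    ← ENNReal.ofReal_mul (by positivity), smul_smul, mul_comm t c, abs_of_pos hc,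
    Real.mul_rpow hc.le ht.le]
  congr 2
  have : c ^ (s * p) * (c * c ^ (-(s * p) - 1)) = 1 := by
    rw [Real.rpow_sub hc, Real.rpow_one, mul_div_cancel₀ _ hc.ne', ← Real.rpow_add hc]
    simp
  linear_combination (- t ^ (-(s * p) - 1)) * this

theorem dirEnergy_smul_le (hs : 0 < s) (hp : 1 ≤ p) (hf : AEStronglyMeasurable f volume) {c : ℝ}
    (hc : |c| ≤ 1) (ξ : E N) : dirEnergy s p f (c • ξ) ≤ dirEnergy s p f ξ := by
  have hsp : 0 ≤ s * p := by nlinarith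
  have key : ∀ c : ℝ, 0 < c → c ≤ 1 → dirEnergy s p f (c • ξ) ≤ dirEnergy s p f ξ := by
    intro c h0 h1
    rw [dirEnergy_smul h0]
    refine (mul_le_mul_left (ENNReal.ofReal_le_one.2 (Real.rpow_le_one h0.le h1 hsp)) _).trans ?_
    rw [one_mul]
  rcases lt_trichotomy c 0 with h | h | h
  · rw [← neg_neg c, neg_smul, dirEnergy_neg hf]
    exact key _ (by linarith) (by rw [abs_of_neg h] at hc; exact hc)
  · simp [h, dirEnergy_zero hp]
  · exact key c h (by rw [abs_of_pos h] at hc; exact hc)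

/-- With the weight absorbed into `F`, this is Minkowski's inequality in `L^p((0, ∞), dt)` applied
to the subadditivity of the differences. -/
theorem dirEnergy_add_le (hp : 1 ≤ p) (hf : AEStronglyMeasurable f volume) (h k : E N) :
    dirEnergy s p f (h + k) ^ (1 / p) ≤
      dirEnergy s p f h ^ (1 / p) + dirEnergy s p f k ^ (1 / p) := by
  have hp0 : 0 < p := by linarith
  have hm := measurable_eLpNorm_diff hp hf
  let F : E N → ℝ → ℝ≥0∞ := fun h t => ENNReal.ofReal (t ^ (-(s * p) - 1)) ^ (1 / p) *
    eLpNorm (diff (t • h) f) (ENNReal.ofReal p) volume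
  have hF : ∀ h, Measurable (F h) := fun h =>
    Measurable.mul (by fun_prop) (hm.comp (by fun_prop))
  have e : ∀ h, dirEnergy s p f h = ∫⁻ t in Ioi (0 : ℝ), F h t ^ p := fun h => by
    refine lintegral_congr fun t => ?_
    rw [ENNReal.mul_rpow_of_nonneg _ _ hp0.le, ← ENNReal.rpow_mul, one_div,
      inv_mul_cancel₀ hp0.ne', ENNReal.rpow_one]
  rw [e, e, e]
  refine le_trans ?_ (ENNReal.lintegral_Lp_add_le (hF h).aemeasurable (hF k).aemeasurable hp)
  refine ENNReal.rpow_le_rpow (lintegral_mono fun t => ENNReal.rpow_le_rpow ?_ hp0.le) (by positivity)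
  simp only [F, Pi.add_apply, ← mul_add, smul_add]
  gcongr
  exact eLpNorm_diff_add_le hf (by simpa using hp) _ _

theorem dirEnergy_sum_le {ι : Type*} (hp : 1 ≤ p) (hf : AEStronglyMeasurable f volume)
    (S : Finset ι) (v : ι → E N) :
    dirEnergy s p f (∑ i ∈ S, v i) ^ (1 / p) ≤ ∑ i ∈ S, dirEnergy s p f (v i) ^ (1 / p) := by
  have hp0 : 0 < p := by linarith
  induction S using Finset.cons_induction with
  | empty => simp [dirEnergy_zero hp, hp0]
  | cons a S ha ih =>
    rw [Finset.sum_cons, Finset.sum_cons]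
    exact (dirEnergy_add_le hp hf _ _).trans (by gcongr)

/-! ### Polar coordinates. -/

theorem lintegral_polar (hN : N ≠ 0) {F : E N → ℝ≥0∞} (hF : Measurable F) :
    ∫⁻ x, F x = ∫⁻ ξ : Metric.sphere (0 : E N) 1, (∫⁻ r in Ioi (0 : ℝ),
      ENNReal.ofReal (r ^ (N - 1)) * F (r • (ξ : E N))) ∂(surf N) := by
  have : Nonempty (Fin N) := ⟨⟨0, Nat.pos_of_ne_zero hN⟩⟩
  have hmp := (volume : Measure (E N)).measurePreserving_homeomorphUnitSphereProd
  have hG : Measurable fun z : Metric.sphere (0 : E N) 1 × Ioi (0 : ℝ) =>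
      F ((z.2 : ℝ) • (z.1 : E N)) := hF.comp (by fun_prop)
  have h1 : ∫⁻ x, F x = ∫⁻ x : ({0}ᶜ : Set (E N)), F (x : E N) ∂(Measure.comap Subtype.val volume) := by
    rw [lintegral_subtype_comap (measurableSet_singleton _).compl F]
    rw [restrict_compl_singleton]
  have h2 : ∀ x : ({0}ᶜ : Set (E N)), F (x : E N) =
      (fun z : Metric.sphere (0 : E N) 1 × Ioi (0 : ℝ) => F ((z.2 : ℝ) • (z.1 : E N)))
        (homeomorphUnitSphereProd (E N) x) := fun x => by
    have : ‖(x : E N)‖ ≠ 0 := norm_ne_zero_iff.2 x.2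
    simp [smul_smul, this]
  rw [h1, lintegral_congr h2, hmp.lintegral_comp hG, lintegral_prod _ hG.aemeasurable]
  refine lintegral_congr fun ξ => ?_
  have hGξ : Measurable fun r : Ioi (0 : ℝ) => F ((r : ℝ) • (ξ : E N)) := hF.comp (by fun_prop)
  rw [Measure.volumeIoiPow, lintegral_withDensity_eq_lintegral_mul _ (by fun_prop) hGξ]
  simp only [Pi.mul_apply]
  rw [← lintegral_subtype_comap measurableSet_Ioi
    (fun r : ℝ => ENNReal.ofReal (r ^ (N - 1)) * F (r • (ξ : E N)))]
  simp

/-- The radial weights combine as `r^(N-1) r^(-sp-N) = r^(-sp-1)`, which is the weight in the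
directional energy. -/
theorem seminorm_rpow (hN : N ≠ 0) (hp : 1 ≤ p) (hf : AEStronglyMeasurable f volume) :
    seminorm s p f ^ p = ∫⁻ ξ : Metric.sphere (0 : E N) 1, dirEnergy s p f ξ ∂(surf N) := by
  have hp0 : 0 < p := by linarith
  have hm := measurable_eLpNorm_diff hp hf
  rw [seminorm, ← ENNReal.rpow_mul, one_div, inv_mul_cancel₀ hp0.ne', ENNReal.rpow_one,
    lintegral_polar hN (F := fun h => eLpNorm (diff h f) (ENNReal.ofReal p) volume ^ p /
      ENNReal.ofReal (‖h‖ ^ (s * p + N))) ((hm.pow_const p).div (by fun_prop))]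
  refine lintegral_congr fun ξ => setLIntegral_congr_fun measurableSet_Ioi fun r (hr : 0 < r) => ?_
  have hn : ‖r • (ξ : E N)‖ = r := by simp [norm_smul, abs_of_pos hr]
  rw [hn, div_eq_mul_inv, mul_comm (_ ^ p), ← mul_assoc, ← ENNReal.ofReal_inv_of_pos (by positivity),
    ← ENNReal.ofReal_mul (by positivity)]
  congr 2
  rw [← Real.rpow_neg hr.le, ← Real.rpow_natCast, ← Real.rpow_add hr,
    Nat.cast_sub (Nat.one_le_iff_ne_zero.2 hN)]
  congr 1
  push_cast
  ring

/-- For `0 < r < 1` both `r^(N-1) ≤ 1` and `A (r ξ) ≤ A ξ`; this crude bound keeps the constant free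
of `s` and `p`. -/
theorem lintegral_unitBall_dirEnergy_le (hN : N ≠ 0) (hs : 0 < s) (hp : 1 ≤ p)
    (hf : AEStronglyMeasurable f volume) :
    ∫⁻ h in Metric.ball (0 : E N) 1, dirEnergy s p f h ≤ seminorm s p f ^ p := by
  have hm := measurable_dirEnergy (s := s) hp hf
  rw [← lintegral_indicator measurableSet_ball, seminorm_rpow hN hp hf,
    lintegral_polar hN (hm.indicator measurableSet_ball)]
  refine lintegral_mono fun ξ => ?_
  have hone : ∫⁻ r : ℝ, (Ioo (0 : ℝ) 1).indicator 1 r = 1 := by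
    rw [lintegral_indicator_one measurableSet_Ioo]; simp
  calc _ ≤ ∫⁻ r : ℝ, (Ioo (0 : ℝ) 1).indicator 1 r * dirEnergy s p f ξ := by
        rw [← lintegral_indicator measurableSet_Ioi]
        refine lintegral_mono fun r => ?_
        simp only [indicator, mem_Ioi, mem_Ioo, Pi.one_apply, mem_ball_zero_iff]
        split_ifs with h1 h2 h3 h3
        · rw [one_mul]
          refine (mul_le_mul' (ENNReal.ofReal_le_one.2 (pow_le_one₀ h1.le h3.2.le))
            (dirEnergy_smul_le hs hp hf (by rw [abs_of_pos h1]; exact h3.2.le) _)).trans ?_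
          rw [one_mul]
        · rw [norm_smul] at h2
          simp [abs_of_pos h1] at h2
          exact absurd ⟨h1, h2⟩ h3
        all_goals simp
    _ = dirEnergy s p f ξ := by
        rw [lintegral_mul_const _ (measurable_one.indicator measurableSet_Ioo), hone, one_mul]

theorem rpow_one_div_rpow (hp : 0 < p) (a : ℝ≥0∞) : (a ^ (1 / p)) ^ p = a := by
  rw [← ENNReal.rpow_mul, one_div, inv_mul_cancel₀ hp.ne', ENNReal.rpow_one]

theorem rpow_rpow_one_div (hp : 0 < p) (a : ℝ≥0∞) : (a ^ p) ^ (1 / p) = a := by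
  rw [← ENNReal.rpow_mul, one_div, mul_inv_cancel₀ hp.ne', ENNReal.rpow_one]

/-- The source of uniformity in `p`: `p`-th roots of dimensional constants stay bounded. -/
theorem rpow_one_div_le_max (hp : 1 ≤ p) (a : ℝ≥0∞) : a ^ (1 / p) ≤ max 1 a := by
  have hp0 : 0 < p := by linarith
  rcases le_total a 1 with h | h
  · exact le_max_of_le_left (ENNReal.rpow_le_one h (by positivity))
  · refine le_max_of_le_right ((ENNReal.rpow_le_rpow_of_exponent_le h ?_).trans_eq
      (ENNReal.rpow_one a))
    rw [one_div]
    exact inv_le_one_of_one_le₀ hp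

theorem sigma_ne_zero (hN : N ≠ 0) : sigma N ≠ 0 := by
  have : Nonempty (Fin N) := ⟨⟨0, Nat.pos_of_ne_zero hN⟩⟩
  rw [sigma, Ne, Measure.measure_univ_eq_zero]
  exact Measure.toSphere_ne_zero _

theorem sigma_ne_top : sigma N ≠ ∞ := measure_ne_top _ _

/-- The constant bounding the directional quantities by the fractional semi-norm. -/
def dirConst (N : ℕ) : ℝ≥0∞ := 2 * max 1 (2 / volume (Metric.ball (0 : E N) (1 / 2)))

theorem dirConst_ne_top : dirConst N ≠ ∞ := by
  have h : volume (Metric.ball (0 : E N) (1 / 2)) ≠ 0 :=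
    (Metric.measure_ball_pos _ _ (by norm_num)).ne'
  unfold dirConst
  exact ENNReal.mul_ne_top (by simp) (max_ne_top (by simp) (ENNReal.div_ne_top (by simp) h))

theorem dirConst_ne_zero : dirConst N ≠ 0 := by
  unfold dirConst
  refine mul_ne_zero (by simp) (ne_of_gt (lt_of_lt_of_le one_pos (le_max_left _ _)))

/-! ### Slicing inequalities with dimensional constants. -/

theorem dirEnergy_le_two_rpow_mul_add (hp : 1 ≤ p) (hf : AEStronglyMeasurable f volume)
    (h k : E N) :
    dirEnergy s p f (h + k) ≤ 2 ^ p * (dirEnergy s p f h + dirEnergy s p f k) := by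
  have hp0 : 0 < p := by linarith
  have h1 := ENNReal.rpow_le_rpow (dirEnergy_add_le (s := s) hp hf h k) hp0.le
  rw [rpow_one_div_rpow hp0] at h1
  refine h1.trans ?_
  calc _ ≤ (2 * (dirEnergy s p f h + dirEnergy s p f k) ^ (1 / p)) ^ p := by
        rw [two_mul]
        gcongr
        · exact le_self_add
        · exact le_add_self
    _ = _ := by rw [ENNReal.mul_rpow_of_nonneg _ _ hp0.le, rpow_one_div_rpow hp0]

/-- Averaging argument: split `u = h + (u - h)` and average over a ball of vectors `h` that is
invariant under `h ↦ u - h` and lies in the unit ball. -/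
theorem dirEnergy_le_seminorm (hN : N ≠ 0) (hs : 0 < s) (hp : 1 ≤ p)
    (hf : AEStronglyMeasurable f volume) {u : E N} (hu : ‖u‖ = 1) :
    dirEnergy s p f u ^ (1 / p) ≤ dirConst N * seminorm s p f := by
  have hp0 : 0 < p := by linarith
  have hm := measurable_dirEnergy (s := s) hp hf
  -- The centre `u / 2` is the fixed point of `h ↦ u - h`, and radius `1 / 2` keeps the ball inside
  -- the unit ball.
  set B := Metric.ball ((1 / 2 : ℝ) • u) (1 / 2) with hB
  set V := volume (Metric.ball (0 : E N) (1 / 2)) with hV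
  have hV0 : V ≠ 0 := (Metric.measure_ball_pos _ _ (by norm_num)).ne'
  have hVt : V ≠ ∞ := measure_ball_lt_top.ne
  have hBV : volume B = V := by rw [hB, Measure.addHaar_ball_center]
  have hsub : B ⊆ Metric.ball 0 1 := by
    refine Metric.ball_subset_ball' ?_
    rw [dist_zero_right, norm_smul, hu]
    norm_num
  have hI : ∫⁻ h in B, dirEnergy s p f h ≤ seminorm s p f ^ p :=
    (lintegral_mono_set hsub).trans (lintegral_unitBall_dirEnergy_le hN hs hp hf)
  have hsymm : ∫⁻ h in B, dirEnergy s p f (u - h) = ∫⁻ h in B, dirEnergy s p f h := by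
    rw [← lintegral_indicator measurableSet_ball, ← lintegral_indicator measurableSet_ball,
      ← lintegral_sub_left_eq_self (fun h => B.indicator (fun h => dirEnergy s p f h) h) u]
    refine lintegral_congr fun h => ?_
    have : u - h ∈ B ↔ h ∈ B := by
      have e : u - h - (1 / 2 : ℝ) • u = -(h - (1 / 2 : ℝ) • u) := by module
      rw [hB, mem_ball_iff_norm, mem_ball_iff_norm, e, norm_neg]
    rw [← hB]
    by_cases hh : h ∈ B
    · rw [indicator_of_mem hh, indicator_of_mem (this.2 hh)]
    · rw [indicator_of_notMem hh, indicator_of_notMem (mt this.1 hh)]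
  have h1 : V * dirEnergy s p f u ≤ 2 ^ p * (2 * seminorm s p f ^ p) := by
    calc V * dirEnergy s p f u = ∫⁻ _ in B, dirEnergy s p f u := by
          rw [setLIntegral_const, hBV, mul_comm]
      _ ≤ ∫⁻ h in B, 2 ^ p * (dirEnergy s p f h + dirEnergy s p f (u - h)) := by
          refine lintegral_mono fun h => ?_
          have := dirEnergy_le_two_rpow_mul_add (s := s) hp hf h (u - h)
          rwa [add_sub_cancel] at this
      _ = 2 ^ p * (2 * ∫⁻ h in B, dirEnergy s p f h) := by
          rw [lintegral_const_mul' _ _ (by simp), lintegral_add_left hm, hsymm, two_mul]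
      _ ≤ _ := by gcongr
  have h2 : dirEnergy s p f u ≤ (2 / V) * (2 * seminorm s p f) ^ p := by
    rw [ENNReal.mul_rpow_of_nonneg _ _ hp0.le, div_eq_mul_inv]
    calc dirEnergy s p f u = V⁻¹ * (V * dirEnergy s p f u) := by
          rw [← mul_assoc, ENNReal.inv_mul_cancel hV0 hVt, one_mul]
      _ ≤ V⁻¹ * (2 ^ p * (2 * seminorm s p f ^ p)) := by gcongr
      _ = _ := by ring
  calc dirEnergy s p f u ^ (1 / p) ≤ ((2 / V) * (2 * seminorm s p f) ^ p) ^ (1 / p) := by gcongr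
    _ = (2 / V) ^ (1 / p) * (2 * seminorm s p f) := by
        rw [ENNReal.mul_rpow_of_nonneg _ _ (by positivity), rpow_rpow_one_div hp0]
    _ ≤ max 1 (2 / V) * (2 * seminorm s p f) := by
        gcongr
        exact rpow_one_div_le_max hp _
    _ = _ := by rw [dirConst]; ring

theorem sliceSum_le_seminorm (hN : N ≠ 0) (hs : 0 < s) (hp : 1 ≤ p)
    (hf : AEStronglyMeasurable f volume) (u : OrthonormalBasis (Fin N) ℝ (E N)) :
    sliceSum s p f u ≤ N * dirConst N * seminorm s p f := by
  refine (Finset.sum_le_sum fun i _ => dirEnergy_le_seminorm hN hs hp hf (u.orthonormal.1 i)).trans ?_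
  simp [mul_assoc]

/-- Expand `ξ` in the basis: its coefficients have absolute value at most one, so subadditivity and
monotonicity under scaling suffice. -/
theorem dirEnergy_le_sliceSum (hs : 0 < s) (hp : 1 ≤ p) (hf : AEStronglyMeasurable f volume)
    (u : OrthonormalBasis (Fin N) ℝ (E N)) {ξ : E N} (hξ : ‖ξ‖ = 1) :
    dirEnergy s p f ξ ^ (1 / p) ≤ sliceSum s p f u := by
  have hp0 : 0 < p := by linarith
  rw [← u.sum_repr ξ]
  refine (dirEnergy_sum_le hp hf _ _).trans (Finset.sum_le_sum fun i _ => ?_)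
  refine ENNReal.rpow_le_rpow (dirEnergy_smul_le hs hp hf ?_ _) (by positivity)
  rw [← hξ, ← u.repr.norm_map ξ]
  exact PiLp.norm_apply_le (u.repr ξ) i

theorem seminorm_le_sliceSum (hN : N ≠ 0) (hs : 0 < s) (hp : 1 ≤ p)
    (hf : AEStronglyMeasurable f volume) (u : OrthonormalBasis (Fin N) ℝ (E N)) :
    seminorm s p f ≤ max 1 (sigma N) * sliceSum s p f u := by
  have hp0 : 0 < p := by linarith
  rw [← rpow_rpow_one_div hp0 (seminorm s p f), seminorm_rpow hN hp hf]
  calc _ ≤ (∫⁻ _ : Metric.sphere (0 : E N) 1, sliceSum s p f u ^ p ∂(surf N)) ^ (1 / p) := by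
        gcongr with ξ
        rw [← rpow_one_div_rpow hp0 (dirEnergy s p f ξ)]
        gcongr
        exact dirEnergy_le_sliceSum hs hp hf u (by simp)
    _ = sigma N ^ (1 / p) * sliceSum s p f u := by
        rw [lintegral_const, mul_comm, ENNReal.mul_rpow_of_nonneg _ _ (by positivity),
          rpow_rpow_one_div hp0, sigma]
    _ ≤ _ := by
        gcongr
        exact rpow_one_div_le_max hp _

/-! ### The best slicing constants. -/

theorem sliceUpper_le (hN : N ≠ 0) (hs : 0 < s) (hp : 1 ≤ p) :
    sliceUpper N s p ≤ max 1 (sigma N) :=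
  sInf_le fun _ hf u => seminorm_le_sliceSum hN hs hp hf.1.aestronglyMeasurable u

theorem le_sliceLower (hN : N ≠ 0) (hs : 0 < s) (hp : 1 ≤ p) :
    (N * dirConst N)⁻¹ ≤ sliceLower N s p := by
  refine le_sSup fun f hf u => ?_
  have h0 : N * dirConst N ≠ 0 := mul_ne_zero (by exact_mod_cast hN) dirConst_ne_zero
  have ht : N * dirConst N ≠ ∞ := ENNReal.mul_ne_top (by simp) dirConst_ne_top
  rw [ENNReal.inv_mul_le_iff h0 ht]
  exact sliceSum_le_seminorm hN hs hp hf.1.aestronglyMeasurable u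

theorem sliceLower_mul_sliceSum_le (hf : MemDotW s p f) (u : OrthonormalBasis (Fin N) ℝ (E N)) :
    sliceLower N s p * sliceSum s p f u ≤ seminorm s p f := by
  rw [sliceLower, ENNReal.sSup_mul]
  exact iSup₂_le fun K hK => hK f hf u

theorem seminorm_le_sliceUpper_mul (hN : N ≠ 0) (hs : 0 < s) (hp : 1 ≤ p) (hf : MemDotW s p f)
    (u : OrthonormalBasis (Fin N) ℝ (E N)) :
    seminorm s p f ≤ sliceUpper N s p * sliceSum s p f u := by
  have hfm := hf.1.aestronglyMeasurable
  -- Passing to the infimum divides by the slice sum; when it vanishes, the explicit slicing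
  -- inequality already forces a zero seminorm.
  by_cases h0 : sliceSum s p f u = 0
  · have := seminorm_le_sliceSum hN hs hp hfm u
    rw [h0] at this ⊢
    simpa using this
  have ht : sliceSum s p f u ≠ ∞ := by
    refine ((sliceSum_le_seminorm hN hs hp hfm u).trans_lt ?_).ne
    exact ENNReal.mul_lt_top (ENNReal.mul_lt_top (by simp) dirConst_ne_top.lt_top) hf.2
  rw [← ENNReal.div_le_iff h0 ht]
  refine le_sInf fun K hK => ?_
  rw [ENNReal.div_le_iff h0 ht]
  exact hK f hf u

theorem sliceLower_le_sliceUpper (hN : N ≠ 0) (hs : 0 < s) (hp : 1 ≤ p) (hf : MemDotW s p f)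
    (h0 : seminorm s p f ≠ 0) : sliceLower N s p ≤ sliceUpper N s p := by
  have hfm := hf.1.aestronglyMeasurable
  let u := EuclideanSpace.basisFun (Fin N) ℝ
  have h1 : sliceSum s p f u ≠ 0 := fun h => h0 <| by
    simpa [h] using seminorm_le_sliceSum hN hs hp hfm u
  have ht : sliceSum s p f u ≠ ∞ := by
    refine ((sliceSum_le_seminorm hN hs hp hfm u).trans_lt ?_).ne
    exact ENNReal.mul_lt_top (ENNReal.mul_lt_top (by simp) dirConst_ne_top.lt_top) hf.2
  exact (ENNReal.mul_le_mul_iff_left h1 ht).1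
    ((sliceLower_mul_sliceSum_le hf u).trans (seminorm_le_sliceUpper_mul hN hs hp hf u))

/-! ### The affine energy against the seminorm. -/

/-- Hölder with exponents `(1 + b) / b` and `1 + b`, applied to `1 = A^(b/(1+b)) A^(-b/(1+b))`,
gives `σ ≤ I^(b/(1+b)) J^(1/(1+b))`. The power `(N + sp) / (Np)` of this is the claim after division
by `J^(s/N)`. -/
theorem affineEnergy_le_seminorm (hN : N ≠ 0) (hs : 0 < s) (hp : 1 ≤ p)
    (hf : AEStronglyMeasurable f volume) (ht : seminorm s p f ≠ ∞) :
    affineEnergy s p f ≤ seminorm s p f := by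
  have hp0 : 0 < p := by linarith
  have hN0 : (0 : ℝ) < N := by exact_mod_cast Nat.pos_of_ne_zero hN
  set b : ℝ := N / (s * p) with hb
  have hb0 : 0 < b := by positivity
  have hm : Measurable fun ξ : Metric.sphere (0 : E N) 1 => dirEnergy s p f ξ :=
    (measurable_dirEnergy hp hf).comp measurable_subtype_coe
  set I := ∫⁻ ξ : Metric.sphere (0 : E N) 1, dirEnergy s p f ξ ∂(surf N) with hI
  set J := ∫⁻ ξ : Metric.sphere (0 : E N) 1, dirEnergy s p f ξ ^ (-b) ∂(surf N) with hJ
  have hIs : seminorm s p f = I ^ (1 / p) := by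
    rw [hI, ← seminorm_rpow hN hp hf, rpow_rpow_one_div hp0]
  have hIt : I ≠ ∞ := by
    rw [hI, ← seminorm_rpow hN hp hf]
    exact ENNReal.rpow_ne_top_of_nonneg hp0.le ht
  have hE : affineEnergy s p f = sigma N ^ ((N + s * p) / (N * p)) * J ^ (-(s / N)) := rfl
  rw [hE, hIs]
  -- If `J = ∞` the affine energy is zero; otherwise `A` is positive almost everywhere, as the
  -- factorization of `1` requires.
  by_cases hJt : J = ∞
  · rw [hJt, ENNReal.top_rpow_of_neg (by simp; positivity), mul_zero]
    exact zero_le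
  have hpos : ∀ᵐ ξ : Metric.sphere (0 : E N) 1 ∂(surf N),
      dirEnergy s p f ξ ^ (-b) < ∞ := ae_lt_top (hm.pow_const _) hJt
  have hfin : ∀ᵐ ξ : Metric.sphere (0 : E N) 1 ∂(surf N), dirEnergy s p f ξ < ∞ :=
    ae_lt_top hm hIt
  have hconj : Real.HolderConjugate ((1 + b) / b) (1 + b) := by
    rw [Real.holderConjugate_iff]
    refine ⟨by rw [lt_div_iff₀ hb0]; linarith, by field_simp; ring⟩
  have hH := ENNReal.lintegral_mul_le_Lp_mul_Lq (surf N) hconj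
    (f := fun ξ => dirEnergy s p f (ξ : E N) ^ (b / (1 + b)))
    (g := fun ξ => dirEnergy s p f (ξ : E N) ^ (-(b / (1 + b))))
    (hm.pow_const _).aemeasurable (hm.pow_const _).aemeasurable
  have e1 : ∫⁻ ξ : Metric.sphere (0 : E N) 1, dirEnergy s p f (ξ : E N) ^ (b / (1 + b)) *
      dirEnergy s p f (ξ : E N) ^ (-(b / (1 + b))) ∂(surf N) = sigma N := by
    rw [sigma, ← lintegral_one]
    refine lintegral_congr_ae ?_
    filter_upwards [hpos, hfin] with ξ h1 h2
    have h0 : dirEnergy s p f (ξ : E N) ≠ 0 := fun h => by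
      rw [h, ENNReal.zero_rpow_of_neg (by linarith)] at h1
      exact lt_irrefl _ h1
    rw [← ENNReal.rpow_add _ _ h0 h2.ne, add_neg_cancel, ENNReal.rpow_zero]
  have e2 : ∀ a : ℝ≥0∞, (a ^ (b / (1 + b))) ^ ((1 + b) / b) = a := fun a => by
    rw [← ENNReal.rpow_mul, show b / (1 + b) * ((1 + b) / b) = 1 by field_simp, ENNReal.rpow_one]
  have e3 : ∀ a : ℝ≥0∞, (a ^ (-(b / (1 + b)))) ^ (1 + b) = a ^ (-b) := fun a => by
    rw [← ENNReal.rpow_mul, show -(b / (1 + b)) * (1 + b) = -b by field_simp]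
  simp only [Pi.mul_apply] at hH
  rw [e1] at hH
  simp only [e2, e3] at hH
  rw [← hI, ← hJ] at hH
  have hJ0 : J ≠ 0 := fun h => by
    rw [h, ENNReal.zero_rpow_of_pos (by positivity), mul_zero] at hH
    exact sigma_ne_zero hN (le_zero_iff.1 hH)
  have hH' := ENNReal.rpow_le_rpow hH (show 0 ≤ (N + s * p) / (N * p) by positivity)
  have hx1 : 1 / ((1 + b) / b) * ((N + s * p) / (N * p)) = 1 / p := by
    rw [hb]; field_simp; ring
  have hx2 : 1 / (1 + b) * ((N + s * p) / (N * p)) = s / N := by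
    rw [hb]; field_simp; ring
  rw [ENNReal.mul_rpow_of_nonneg _ _ (by positivity), ← ENNReal.rpow_mul, ← ENNReal.rpow_mul,
    hx1, hx2] at hH'
  calc _ ≤ I ^ (1 / p) * J ^ (s / N) * J ^ (-(s / N)) := by gcongr
    _ = I ^ (1 / p) := by
      rw [mul_assoc, ← ENNReal.rpow_add _ _ hJ0 hJt, add_neg_cancel, ENNReal.rpow_zero, mul_one]

theorem sobolevConst_le_affineSobolevConst (hN : N ≠ 0) (hs : 0 < s) (hp : 1 ≤ p) :
    sobolevConst N s p ≤ affineSobolevConst N s p := by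
  refine sInf_le_sInf fun C hC f hf => (hC f hf).trans ?_
  gcongr
  exact affineEnergy_le_seminorm hN hs hp hf.1.aestronglyMeasurable hf.2.ne

/-! ### Unimodular maps and minimizers. -/

theorem measurePreserving_of_det_eq_one {T : E N →ₗ[ℝ] E N} (hT : LinearMap.det T = 1) :
    MeasurePreserving T (volume : Measure (E N)) volume := by
  refine ⟨T.continuous_of_finiteDimensional.measurable, ?_⟩
  rw [Measure.map_linearMap_addHaar_eq_smul_addHaar _ (by simp [hT])]
  simp [hT]

theorem dirEnergy_comp {T : E N →ₗ[ℝ] E N} (hT : LinearMap.det T = 1)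
    (hf : AEStronglyMeasurable f volume) (ξ : E N) :
    dirEnergy s p (f ∘ T) ξ = dirEnergy s p f (T ξ) := by
  unfold dirEnergy
  refine lintegral_congr fun t => ?_
  have e : diff (t • ξ) (f ∘ T) = diff (t • T ξ) f ∘ T := by
    ext x
    simp [diff]
  have hq := eLpNorm_comp_measurePreserving (p := ENNReal.ofReal p)
    (aestronglyMeasurable_diff hf (t • T ξ)) (measurePreserving_of_det_eq_one hT)
  rw [e, hq]

theorem locallyIntegrable_comp {T : E N →ₗ[ℝ] E N} (hT : LinearMap.det T = 1)
    (hf : LocallyIntegrable f volume) : LocallyIntegrable (f ∘ T) volume := by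
  have hmp := measurePreserving_of_det_eq_one hT
  have hc : Continuous T := T.continuous_of_finiteDimensional
  rw [locallyIntegrable_iff] at hf ⊢
  intro K hK
  have hinj : Function.Injective T :=
    (LinearMap.equivOfDetNeZero T (by simp [hT])).injective
  have hemb : MeasurableEmbedding T := hc.measurableEmbedding hinj
  exact (hmp.integrableOn_image hemb (f := f) (s := K)).1 (hf _ (hK.image hc))

/-- The linear map which multiplies the vector `u i` of an orthonormal basis by `d i`. -/
def diagMap (u : OrthonormalBasis (Fin N) ℝ (E N)) (d : Fin N → ℝ) : E N →ₗ[ℝ] E N :=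
  Matrix.toLin u.toBasis u.toBasis (Matrix.diagonal d)

theorem det_diagMap (u : OrthonormalBasis (Fin N) ℝ (E N)) (d : Fin N → ℝ) :
    LinearMap.det (diagMap u d) = ∏ i, d i := by
  rw [diagMap, LinearMap.det_toLin, Matrix.det_diagonal]

theorem diagMap_apply_basis (u : OrthonormalBasis (Fin N) ℝ (E N)) (d : Fin N → ℝ) (i : Fin N) :
    diagMap u d (u i) = d i • u i := by
  have := Matrix.toLin_self u.toBasis u.toBasis (Matrix.diagonal d) i
  rw [OrthonormalBasis.coe_toBasis] at this
  rw [diagMap, this, Finset.sum_eq_single i]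
  · simp
  · intro j _ hj
    simp [Matrix.diagonal_apply_ne _ hj]
  · simp

theorem exists_orthonormalBasis_apply_eq (i : Fin N) {ξ : E N} (hξ : ‖ξ‖ = 1) :
    ∃ u : OrthonormalBasis (Fin N) ℝ (E N), u i = ξ := by
  obtain ⟨u, hu⟩ := Orthonormal.exists_orthonormalBasis_extension_of_card_eq (𝕜 := ℝ)
    (E := E N) (ι := Fin N) (by simp) (v := fun _ => ξ) (s := {i}) (by
      constructor
      · simp [hξ]
      · intro a b hab
        exact absurd (Subsingleton.elim a b) hab)
  exact ⟨u, hu i rfl⟩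

/-- The comparison of a minimizer with its composition with the map which stretches the direction
`ξ` by `l` and contracts the orthogonal ones. -/
theorem seminorm_le_of_isUnimodularMin (hN : 2 ≤ N) (hs : 0 < s) (hp : 1 ≤ p)
    (hf : MemDotW s p f) (hmin : IsUnimodularMin s p f) (i : Fin N)
    (u : OrthonormalBasis (Fin N) ℝ (E N)) {l : ℝ} (hl : 0 < l) :
    seminorm s p f ≤ sliceUpper N s p *
      (ENNReal.ofReal (l ^ s) * dirEnergy s p f (u i) ^ (1 / p) +
        ENNReal.ofReal (l ^ (-(s / ((N : ℝ) - 1)))) *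
          ∑ j ∈ Finset.univ.erase i, dirEnergy s p f (u j) ^ (1 / p)) := by
  have hN0 : N ≠ 0 := by omega
  have hp0 : 0 < p := by linarith
  have hN1 : (0 : ℝ) < N - 1 := by
    have : (2 : ℝ) ≤ N := by exact_mod_cast hN
    linarith
  have hfm := hf.1.aestronglyMeasurable
  -- The contraction factor is forced by `l * m ^ (N - 1) = 1`.
  set m : ℝ := l ^ (-(1 / ((N : ℝ) - 1))) with hm
  have hm0 : 0 < m := by positivity
  set d : Fin N → ℝ := fun j => if j = i then l else m with hd
  have hd0 : ∀ j, 0 < d j := fun j => by simp only [hd]; split_ifs <;> assumption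
  set T := diagMap u d with hT
  have hdet : LinearMap.det T = 1 := by
    rw [hT, det_diagMap, ← Finset.mul_prod_erase _ _ (Finset.mem_univ i),
      Finset.prod_congr rfl (g := fun _ => m) fun j hj => by simp [hd, Finset.ne_of_mem_erase hj],
      Finset.prod_const, Finset.card_erase_of_mem (Finset.mem_univ i), Finset.card_univ,
      Fintype.card_fin, hm, ← Real.rpow_natCast, ← Real.rpow_mul hl.le,
      Nat.cast_sub (by omega), Nat.cast_one, neg_mul, one_div, inv_mul_cancel₀ hN1.ne',
      Real.rpow_neg_one]
    simp [hd, hl.ne']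
  have hTm := measurePreserving_of_det_eq_one hdet
  have hdir : ∀ j, dirEnergy s p (f ∘ T) (u j) ^ (1 / p) =
      ENNReal.ofReal (d j ^ s) * dirEnergy s p f (u j) ^ (1 / p) := fun j => by
    rw [dirEnergy_comp hdet hfm, hT, diagMap_apply_basis, dirEnergy_smul (hd0 j),
      ENNReal.mul_rpow_of_nonneg _ _ (by positivity),
      ENNReal.ofReal_rpow_of_nonneg (Real.rpow_nonneg (hd0 j).le _) (by positivity),
      ← Real.rpow_mul (hd0 j).le, mul_assoc, mul_one_div_cancel hp0.ne', mul_one]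
  -- Finiteness comes from slicing in the same basis, where `T` only rescales each directional
  -- energy.
  have hfT : MemDotW s p (f ∘ T) := by
    refine ⟨locallyIntegrable_comp hdet hf.1, ?_⟩
    refine (seminorm_le_sliceSum hN0 hs hp (hfm.comp_measurePreserving hTm) u).trans_lt ?_
    refine ENNReal.mul_lt_top (max_lt (by simp) sigma_ne_top.lt_top) ?_
    refine ENNReal.sum_lt_top.2 fun j _ => ?_
    rw [hdir]
    exact ENNReal.mul_lt_top (by simp) ((dirEnergy_le_seminorm hN0 hs hp hfm
      (u.orthonormal.1 j)).trans_lt (ENNReal.mul_lt_top dirConst_ne_top.lt_top hf.2))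
  refine (hmin T hdet).trans ((seminorm_le_sliceUpper_mul hN0 hs hp hfT u).trans_eq ?_)
  rw [sliceSum, ← Finset.add_sum_erase _ _ (Finset.mem_univ i), Finset.mul_sum]
  congr 2
  · rw [hdir]
    simp [hd]
  · refine Finset.sum_congr rfl fun j hj => ?_
    rw [hdir]
    simp only [hd, Finset.ne_of_mem_erase hj, if_false, hm]
    rw [← Real.rpow_mul hl.le]
    congr 3
    ring

theorem minConst_mul_seminorm_le (hN : 2 ≤ N) (hs : 0 < s) (hp : 1 ≤ p)
    (hf : MemDotW s p f) (hmin : IsUnimodularMin s p f) {ξ : E N} (hξ : ‖ξ‖ = 1) :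
    minConst N s p * seminorm s p f ≤ dirEnergy s p f ξ ^ (1 / p) := by
  have hN0 : N ≠ 0 := by omega
  have hN1 : (0 : ℝ) < N - 1 := by
    have : (2 : ℝ) ≤ N := by exact_mod_cast hN
    linarith
  by_cases h0 : seminorm s p f = 0
  · simp [h0]
  have hK := sliceLower_le_sliceUpper hN0 hs hp hf h0
  have hKt : sliceUpper N s p ≠ ∞ :=
    ((sliceUpper_le hN0 hs hp).trans_lt (max_lt (by simp) sigma_ne_top.lt_top)).ne
  have hK0 : sliceLower N s p ≠ 0 := by
    refine ((ENNReal.inv_pos.2 ?_).trans_le (le_sliceLower hN0 hs hp)).ne'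
    exact ENNReal.mul_ne_top (by simp) dirConst_ne_top
  obtain ⟨u, hu⟩ := exists_orthonormalBasis_apply_eq (⟨0, by omega⟩ : Fin N) hξ
  rw [minConst, ENNReal.iSup_mul]
  refine iSup_le fun l => ?_
  rw [ENNReal.iSup_mul]
  refine iSup_le fun hl => ?_
  have hl1 : (1 : ℝ) < l := by
    have : (1 : ℝ≥0∞) < l := by
      refine lt_of_le_of_lt (ENNReal.one_le_rpow ?_ (by positivity)) hl
      rw [ENNReal.le_div_iff_mul_le (.inl hK0) (.inl (ne_top_of_le_ne_top hKt hK)), one_mul]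
      exact hK
    exact_mod_cast this
  have hl0 : (0 : ℝ) < l := by linarith
  have hmain := seminorm_le_of_isUnimodularMin hN hs hp hf hmin ⟨0, by omega⟩ u hl0
  have hlow := sliceLower_mul_sliceSum_le hf u
  rw [sliceSum, ← Finset.add_sum_erase _ _ (Finset.mem_univ ⟨0, by omega⟩)] at hlow
  rw [← ENNReal.ofReal_rpow_of_pos hl0, ← ENNReal.ofReal_rpow_of_pos hl0,
    ENNReal.ofReal_coe_nnreal] at hmain
  rw [hu] at hmain hlow
  have hmL : (l : ℝ≥0∞) ^ (-(s / ((N : ℝ) - 1))) ≤ (l : ℝ≥0∞) ^ s := by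
    refine ENNReal.rpow_le_rpow_of_exponent_le (by exact_mod_cast hl1.le) ?_
    have : 0 < s / ((N : ℝ) - 1) := by positivity
    linarith
  -- Writing `λ^s = m + D` turns the subtraction in the denominator into the genuine difference `D`.
  obtain ⟨D, hD⟩ := le_iff_exists_add.1 hmL
  have hmt : (l : ℝ≥0∞) ^ (-(s / ((N : ℝ) - 1))) ≠ ∞ := by
    refine ENNReal.rpow_ne_top_of_ne_zero ?_ (by simp)
    exact_mod_cast hl0.ne'
  rw [hD] at hmain ⊢
  generalize (l : ℝ≥0∞) ^ (-(s / ((N : ℝ) - 1))) = m at *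
  generalize sliceLower N s p = K₁ at *
  generalize sliceUpper N s p = K₂ at *
  generalize dirEnergy s p f ξ ^ (1 / p) = a at *
  generalize ∑ j ∈ Finset.univ.erase (⟨0, by omega⟩ : Fin N), dirEnergy s p f (u j) ^ (1 / p) = r
    at *
  have hSt := hf.2.ne
  generalize seminorm s p f = S at *
  rw [ENNReal.add_sub_cancel_left hmt, mul_comm, ← mul_div_assoc]
  refine ENNReal.div_le_of_le_mul ?_
  rw [ENNReal.mul_sub (fun _ _ => hSt), tsub_le_iff_right]
  -- The part with factor `m` regroups into a full slice sum, bounded by `S` through `K₁`; in the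
  -- rest, `K₁ ≤ K₂` produces the square of `K₂`.
  calc S * K₁ ≤ K₂ * ((m + D) * a + m * r) * K₁ := by gcongr
    _ = K₂ * K₁ * D * a + K₂ * m * (K₁ * (a + r)) := by ring
    _ ≤ K₂ * K₂ * D * a + K₂ * m * S := by gcongr
    _ = a * (K₂ ^ 2 * D) + S * (K₂ * m) := by ring

/-! ### Uniform bounds for `C¹` and `K_{s,p,N}`. -/

/-- A lower bound for the constant `minConst` which only depends on the dimension. -/
def minConstBound (N : ℕ) : ℝ≥0∞ :=
  (N * dirConst N)⁻¹ / 2 /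
    (max 1 (sigma N) ^ 2 * (2 * (max 1 (sigma N) * (N * dirConst N))) ^ ((N : ℝ) - 1))

theorem minConstBound_ne_zero (hN : 2 ≤ N) : minConstBound N ≠ 0 := by
  have hN1 : (0 : ℝ) ≤ N - 1 := by
    have : (2 : ℝ) ≤ N := by exact_mod_cast hN
    linarith
  have hd : N * dirConst N ≠ ∞ := ENNReal.mul_ne_top (by simp) dirConst_ne_top
  have hs : max 1 (sigma N) ≠ ∞ := max_ne_top (by simp) sigma_ne_top
  refine (ENNReal.div_pos ?_ ?_).ne'
  · exact (ENNReal.div_pos (ENNReal.inv_ne_zero.2 hd) (by simp)).ne'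
  · exact ENNReal.mul_ne_top (ENNReal.pow_ne_top hs) (ENNReal.rpow_ne_top_of_nonneg hN1
      (ENNReal.mul_ne_top (by simp) (ENNReal.mul_ne_top hs hd)))

/-- Treating this degenerate case removes the need to exhibit a function with nonzero seminorm: here
`K² = 0` and `K¹ = ∞`, and `λ = 1` already gives the value `∞`. -/
theorem minConst_eq_top (hN : 2 ≤ N) (hs : 0 < s) (hp : 1 ≤ p)
    (h : ∀ f : E N → ℝ, MemDotW s p f → seminorm s p f = 0) : minConst N s p = ∞ := by
  have hN0 : N ≠ 0 := by omega
  have hN1 : (0 : ℝ) < N - 1 := by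
    have : (2 : ℝ) ≤ N := by exact_mod_cast hN
    linarith
  have h2 : sliceUpper N s p = 0 := le_zero_iff.1 <| sInf_le fun f hf u => by simp [h f hf]
  have h1 : sliceLower N s p = ∞ := top_le_iff.1 <| le_sSup fun f hf u => by
    have := sliceSum_le_seminorm hN0 hs hp hf.1.aestronglyMeasurable u
    rw [h f hf, mul_zero, le_zero_iff] at this
    simp [this]
  rw [minConst, eq_top_iff]
  refine le_iSup₂_of_le 1 ?_ ?_
  · rw [h1, h2, ENNReal.zero_div, ENNReal.zero_rpow_of_pos (by positivity)]
    simp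
  · simp [h1, h2, ENNReal.div_zero]

theorem minConstBound_le (hN : 2 ≤ N) (hs : 0 < s) (hp : 1 ≤ p) :
    minConstBound N ≤ minConst N s p := by
  have hN0 : N ≠ 0 := by omega
  have hN1 : (0 : ℝ) < N - 1 := by
    have : (2 : ℝ) ≤ N := by exact_mod_cast hN
    linarith
  by_cases h : ∀ f : E N → ℝ, MemDotW s p f → seminorm s p f = 0
  · simp [minConst_eq_top hN hs hp h]
  push Not at h
  obtain ⟨f, hf, h0⟩ := h
  have hK := sliceLower_le_sliceUpper hN0 hs hp hf h0
  have hup := sliceUpper_le hN0 hs hp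
  have hlow := le_sliceLower hN0 hs hp
  have hd : N * dirConst N ≠ ∞ := ENNReal.mul_ne_top (by simp) dirConst_ne_top
  have hKt : sliceUpper N s p ≠ ∞ :=
    (hup.trans_lt (max_lt (by simp) sigma_ne_top.lt_top)).ne
  have hK0 : sliceLower N s p ≠ 0 := ((ENNReal.inv_pos.2 hd).trans_le hlow).ne'
  have hLt : sliceLower N s p ≠ ∞ := ne_top_of_le_ne_top hKt hK
  have hU0 : sliceUpper N s p ≠ 0 := fun h => hK0 (le_zero_iff.1 (h ▸ hK))
  set r := sliceUpper N s p / sliceLower N s p with hr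
  have hr0 : r ≠ 0 := (ENNReal.div_pos hU0 hLt).ne'
  have hrt : r ≠ ∞ := ENNReal.div_ne_top hKt hK0
  have hrle : r ≤ max 1 (sigma N) * (N * dirConst N) := by
    rw [hr, div_eq_mul_inv]
    exact mul_le_mul' hup (ENNReal.inv_le_iff_inv_le.1 hlow)
  have hlt : (2 * r) ^ (((N : ℝ) - 1) / s) ≠ ∞ :=
    ENNReal.rpow_ne_top_of_nonneg (by positivity) (ENNReal.mul_ne_top (by simp) hrt)
  -- With `λ = (2 r)^((N-1)/s)`, the numerator is `K¹ / 2` and `λ^s = (2 r)^(N-1)`; the factor `2`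
  -- makes the condition on `λ` strict.
  obtain ⟨l, hl⟩ := WithTop.ne_top_iff_exists.1 hlt
  change (l : ℝ≥0∞) = _ at hl
  have hls : (l : ℝ≥0∞) ^ s = (2 * r) ^ ((N : ℝ) - 1) := by
    rw [hl, ← ENNReal.rpow_mul, div_mul_cancel₀ _ hs.ne']
  have hlm : (l : ℝ≥0∞) ^ (-(s / ((N : ℝ) - 1))) = (2 * r)⁻¹ := by
    rw [hl, ← ENNReal.rpow_mul, show ((N : ℝ) - 1) / s * -(s / ((N : ℝ) - 1)) = -1 by field_simp,
      ENNReal.rpow_neg_one]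
  have hcond : r ^ (((N : ℝ) - 1) / s) < l := by
    rw [hl]
    refine ENNReal.rpow_lt_rpow ?_ (by positivity)
    rw [two_mul]
    exact ENNReal.lt_add_right hrt hr0
  have hUr : sliceUpper N s p * (2 * r)⁻¹ = sliceLower N s p / 2 := by
    rw [hr, ENNReal.mul_inv (by simp) (by simp), ENNReal.inv_div (.inl hLt) (.inl hK0),
      mul_left_comm, ENNReal.mul_div_cancel hU0 hKt, mul_comm, div_eq_mul_inv]
  refine le_iSup₂_of_le l hcond ?_
  rw [hls, hlm, hUr, ENNReal.sub_half hLt, minConstBound]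
  gcongr
  -- Dropping the subtracted term only enlarges the denominator.
  exact tsub_le_self.trans (by gcongr)

theorem methodConst_le (hN : 2 ≤ N) (hs : 0 < s) (hp : 1 ≤ p) :
    methodConst N s p ≤ max 1 (sigma N)⁻¹ / minConstBound N * sobolevConst N s p := by
  rw [methodConst, ENNReal.rpow_neg, ← ENNReal.inv_rpow, mul_div_assoc, mul_comm]
  gcongr
  · exact rpow_one_div_le_max hp _
  · exact minConstBound_le hN hs hp

end AffineSobolev

end

theorem mainTheorem10 (N : ℕ) (hN : 2 ≤ N) :
    ∃ C : ℝ≥0, ∀ s p : ℝ, 0 < s → s < 1 → 1 ≤ p → s * p < N →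
      -- the constant `C¹` entering `K_{s,p,N}` is admissible in the estimate for minimizers
      (∀ f : AffineSobolev.E N → ℝ, AffineSobolev.MemDotW s p f →
        AffineSobolev.IsUnimodularMin s p f → ∀ ξ : AffineSobolev.E N, ‖ξ‖ = 1 →
          AffineSobolev.minConst N s p * AffineSobolev.seminorm s p f ≤
            AffineSobolev.dirEnergy s p f ξ ^ (1 / p)) ∧
      -- `K_{s,p,N}` against the best Sobolev constant and the best affine Sobolev constant
      AffineSobolev.methodConst N s p ≤ C * AffineSobolev.sobolevConst N s p ∧
      AffineSobolev.methodConst N s p ≤ C * AffineSobolev.affineSobolevConst N s p := by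
  have hC : max 1 (AffineSobolev.sigma N)⁻¹ / AffineSobolev.minConstBound N ≠ ∞ :=
    ENNReal.div_ne_top (max_ne_top (by simp)
      (ENNReal.inv_ne_top.2 (AffineSobolev.sigma_ne_zero (by omega))))
      (AffineSobolev.minConstBound_ne_zero hN)
  refine ⟨(max 1 (AffineSobolev.sigma N)⁻¹ / AffineSobolev.minConstBound N).toNNReal, ?_⟩
  intro s p hs _ hp _
  have hm := AffineSobolev.methodConst_le hN hs hp
  rw [ENNReal.coe_toNNReal hC]
  refine ⟨fun f hf hmin ξ hξ => AffineSobolev.minConst_mul_seminorm_le hN hs hp hf hmin hξ, hm, ?_⟩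
  refine hm.trans ?_
  gcongr
  exact AffineSobolev.sobolevConst_le_affineSobolevConst (by omega) hs hp
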